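/- Let $D\subset\mathbb R^4$ (coordinates $x^1,x^2,y^1,y^2$; superscripts are indices) be a nonempty open set on which $x^1\neq0$, $y^1\neq 0$, $y^2\neq0$, and consider on $D$ the three families of surfaces $$x^i=\mathrm{const},\qquad y^i=\mathrm{const},\qquad f^i(x,y)=\mathrm{const}\quad(i=1,2),\qquad f^1=y^2e^{x^1y^1},\quad f^2=x^2+y^2 .$$ Notation, for a smooth $f$ with $\det(\partial f/\partial x)\ne0\neq\det(\partial f/\partial y)$ (so that the families form a three-web $W(3,2,2)$), with summation over repeated indices. Put $\omega_1^i=\frac{\partial f^i}{\partial x^j}dx^j$, $\omega_2^i=\frac{\partial f^i}{\partial y^j}dy^j$, $\bar g=(\partial f/\partial x)^{-1}$, $\tilde g=(\partial f/\partial y)^{-1}$, $\Gamma^i_{jk}=-\frac{\partial^2f^i}{\partial x^l\partial y^m}\bar g^l_j\tilde g^m_k$, $\omega^i_j=\Gamma^i_{kj}\omega_1^k+\Gamma^i_{jk}\omega_2^k$, $a^i_{jk}=\frac12(\Gamma^i_{jk}-\Gamma^i_{kj})$. The covector $a=(a_1,a_2)$ is given by $a^i_{jk}=\frac12(a_j\delta^i_k-a_k\delta^i_j)$;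 the quantities $p_{ij},q_{ij}$ and $b^i_{jkl}$ are defined by $$da_i-a_j\omega_i^j=p_{ij}\omega_1^j+q_{ij}\omega_2^j,\qquad d\omega^i_j-\omega_j^k\wedge\omega_k^i=b^i_{jkl}\,\omega_1^k\wedge\omega_2^l ,$$ and $p=\frac12(p_{12}-p_{21})$, $q=\frac12(q_{12}-q_{21})$. The web is nonisoclinic if $p^2+q^2>0$ everywhere. Let $\Delta$ be the distribution $a_1\omega_\alpha^1+a_2\omega_\alpha^2=0$ ($\alpha=1,2$). A web is transversally geodesic if for each point and each $\xi\ne0$ in $\mathbb R^2$ there is a smooth immersed surface through the point with tangent plane there $\{\xi^2\omega_\alpha^1=\xi^1\omega_\alpha^2,\ \alpha=1,2\}$, whose tangent plane at each of its points is of this form for some $\xi\neq0$ depending on the point; the corresponding tensor condition is that at each point $b^i_{(jkl)}=\delta^i_{(j}b_{kl)}$ for some $b_{kl}$ (round brackets denote symmetrization). Claim. The given families form a three-web on $D$, with $a\ne0$ everywhere, and it is nonisoclinic. Moreover, on $D$: 1. (Class $A_3$) $\Delta$ is the distribution $\omega_1^2=\omega_2^2=0$ and is integrable; $a_1=0$,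 the form $\omega_1^{\,2}$ (that is, $\omega_j^i$ with $j=1,\,i=2$) vanishes on all vectors annihilated by all $\omega^i_\alpha$, and $p_{11}=q_{11}=0$. 2. (Class $A_{31}$) The integral surfaces of $\Delta$ are geodesically parallel in every affine connection with connection forms $\mathrm{diag}(\theta^i_j,\theta^i_j)$, $\theta^i_j=\omega^i_j+a^i_{jk}(P\omega_1^k+Q\omega_2^k)$, $P,Q$ arbitrary functions, i.e. $\nabla_XV\in\Delta$ for every smooth section $V$ of $\Delta$ and every vector $X$; and $p_{1i}=q_{1i}=0$ for $i=1,2$. 3. (Class $A_{32}$) The two-dimensional three-web cut by the three foliations on any integral surface of $\Delta$ is hexagonal (all sufficiently small hexagonal figures close); and $b^1_{111}=b^2_{111}=0$. 4. (Class $E_{321}$) $p_{1i}=q_{1i}=0$, $p_{21}=q_{21}$, $p_{22}=0$. 5. (Class $G_3$) $p=q\neq0$. 6. $b^2_{jkl}=0$ for all $j,k,l$, but the tensor $b^i_{jkl}$ does not vanish identically on $D$ (the web is not a group web). The web is not transversally geodesic, and the tensor condition $b^i_{(jkl)}=\delta^i_{(j}b_{kl)}$ fails. -/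

import Mathlib

open scoped ContDiff Topology

noncomputable section

namespace Web322

/-! Three-webs `W(3,2,2)` on open subsets of `ℝ⁴`, given by
`x = const`, `y = const`, `f(x, y) = const` with `x, y` and the values of `f` in `ℝ²`.
The indices `1, 2` of the usual tensor notation are `0, 1 : Fin 2` here. -/

/-- Points (and tangent vectors) of `ℝ⁴`, split as `(x, y) = ((x¹, x²), (y¹, y²))`. -/
abbrev Pt : Type := (Fin 2 → ℝ) × (Fin 2 → ℝ)

/-- The matrix `∂fⁱ/∂xʲ`. -/
def dX (f : Pt → Fin 2 → ℝ) (z : Pt) : Matrix (Fin 2) (Fin 2) ℝ :=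
  Matrix.of fun i j => fderiv ℝ f z (Pi.single j 1, 0) i

/-- The matrix `∂fⁱ/∂yʲ`. -/
def dY (f : Pt → Fin 2 → ℝ) (z : Pt) : Matrix (Fin 2) (Fin 2) ℝ :=
  Matrix.of fun i j => fderiv ℝ f z (0, Pi.single j 1) i

/-- `f` defines on the open set `D` a three-web: it is smooth and the leaves of the three
foliations are pairwise transversal. -/
structure IsWeb (f : Pt → Fin 2 → ℝ) (D : Set Pt) : Prop where
  isOpen : IsOpen D
  smooth : ContDiffOn ℝ ∞ f D
  det_dX : ∀ z ∈ D, (dX f z).det ≠ 0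
  det_dY : ∀ z ∈ D, (dY f z).det ≠ 0

/-- The form `ω₁ⁱ = (∂fⁱ/∂xʲ) dxʲ` at `z`, evaluated on `v`. -/
def om1 (f : Pt → Fin 2 → ℝ) (i : Fin 2) (z v : Pt) : ℝ := ∑ j, dX f z i j * v.1 j

/-- The form `ω₂ⁱ = (∂fⁱ/∂yʲ) dyʲ` at `z`, evaluated on `v`. -/
def om2 (f : Pt → Fin 2 → ℝ) (i : Fin 2) (z v : Pt) : ℝ := ∑ j, dY f z i j * v.2 j

/-- The frame vector `e₁ₖ`; with `e₂ₖ` it is the frame dual to the coframe `ω₁ⁱ, ω₂ⁱ`. -/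
def fr1 (f : Pt → Fin 2 → ℝ) (k : Fin 2) (z : Pt) : Pt := (fun l => (dX f z)⁻¹ l k, 0)

/-- The frame vector `e₂ₖ`. -/
def fr2 (f : Pt → Fin 2 → ℝ) (k : Fin 2) (z : Pt) : Pt := (0, fun l => (dY f z)⁻¹ l k)

/-- The mixed derivative `∂²fⁱ/∂xˡ∂yᵐ`. -/
def mixed (f : Pt → Fin 2 → ℝ) (i l m : Fin 2) (z : Pt) : ℝ :=
  fderiv ℝ (fun w => dY f w i m) z (Pi.single l 1, 0)

/-- `Γⁱⱼₖ = - (∂²fⁱ/∂xˡ∂yᵐ) ḡˡⱼ g̃ᵐₖ`, with `ḡ`, `g̃` the inverses of `∂f/∂x`, `∂f/∂y`. -/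
def Gam (f : Pt → Fin 2 → ℝ) (i j k : Fin 2) (z : Pt) : ℝ :=
  -∑ l, ∑ m, mixed f i l m z * (dX f z)⁻¹ l j * (dY f z)⁻¹ m k

/-- The connection form `ωⱼⁱ = Γⁱₖⱼ ω₁ᵏ + Γⁱⱼₖ ω₂ᵏ` (lower index `j`, upper index `i`) at `z`,
evaluated on `v`. -/
def conn (f : Pt → Fin 2 → ℝ) (j i : Fin 2) (z v : Pt) : ℝ :=
  ∑ k, (Gam f i k j z * om1 f k z v + Gam f i j k z * om2 f k z v)

/-- The torsion tensor `aⁱⱼₖ = Γⁱ_[jk]`. -/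
def torsion (f : Pt → Fin 2 → ℝ) (i j k : Fin 2) (z : Pt) : ℝ :=
  (Gam f i j k z - Gam f i k j z) / 2

/-- The covector `a = (a₁, a₂)`, determined by `aⁱⱼₖ = a_[j δⁱ_k]`
(see `torsion_eq`); taking the trace gives `aⱼ = 2 aᵏⱼₖ`. -/
def cov (f : Pt → Fin 2 → ℝ) (j : Fin 2) (z : Pt) : ℝ := 2 * ∑ k, torsion f k j k z

/-- `aⁱⱼₖ = a_[j δⁱ_k]`. -/
theorem torsion_eq (f : Pt → Fin 2 → ℝ) (i j k : Fin 2) (z : Pt) :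
    torsion f i j k z =
      (cov f j z * (if k = i then 1 else 0) - cov f k z * (if j = i then 1 else 0)) / 2 := by
  fin_cases i <;> fin_cases j <;> fin_cases k <;>
    simp [cov, torsion, Fin.sum_univ_two] <;> ring

/-- The covariant differential `∇aᵢ = daᵢ - aⱼ ωᵢʲ` at `z`, evaluated on `v`. -/
def nablaCov (f : Pt → Fin 2 → ℝ) (i : Fin 2) (z v : Pt) : ℝ :=
  fderiv ℝ (cov f i) z v - ∑ j, cov f j z * conn f i j z v

/-- The Pfaffian derivatives `pᵢⱼ`: `∇aᵢ = pᵢⱼ ω₁ʲ + qᵢⱼ ω₂ʲ` (see `nablaCov_eq`). -/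
def pT (f : Pt → Fin 2 → ℝ) (i j : Fin 2) (z : Pt) : ℝ := nablaCov f i z (fr1 f j z)

/-- The Pfaffian derivatives `qᵢⱼ`. -/
def qT (f : Pt → Fin 2 → ℝ) (i j : Fin 2) (z : Pt) : ℝ := nablaCov f i z (fr2 f j z)

theorem conn_add (f : Pt → Fin 2 → ℝ) (j i : Fin 2) (z u v : Pt) :
    conn f j i z (u + v) = conn f j i z u + conn f j i z v := by
  simp [conn, om1, om2, Fin.sum_univ_two]; ring

theorem conn_smul (f : Pt → Fin 2 → ℝ) (j i : Fin 2) (z : Pt) (c : ℝ) (v : Pt) :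
    conn f j i z (c • v) = c * conn f j i z v := by
  simp [conn, om1, om2, Fin.sum_univ_two]; ring

/-- Every vector is expanded in the frame by means of the coframe. -/
theorem expand (f : Pt → Fin 2 → ℝ) (z v : Pt)
    (h1 : (dX f z).det ≠ 0) (h2 : (dY f z).det ≠ 0) :
    v = ∑ j, (om1 f j z v • fr1 f j z + om2 f j z v • fr2 f j z) := by
  have hX := Matrix.nonsing_inv_mul (dX f z) (isUnit_iff_ne_zero.mpr h1)
  have hY := Matrix.nonsing_inv_mul (dY f z) (isUnit_iff_ne_zero.mpr h2)
  have kX : ((dX f z)⁻¹).mulVec ((dX f z).mulVec v.1) = v.1 := by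
    rw [Matrix.mulVec_mulVec, hX, Matrix.one_mulVec]
  have kY : ((dY f z)⁻¹).mulVec ((dY f z).mulVec v.2) = v.2 := by
    rw [Matrix.mulVec_mulVec, hY, Matrix.one_mulVec]
  ext l
  · have := congrFun kX l
    simp only [Matrix.mulVec, dotProduct, Fin.sum_univ_two] at this
    simp [om1, om2, fr1, fr2, Fin.sum_univ_two]
    linarith
  · have := congrFun kY l
    simp only [Matrix.mulVec, dotProduct, Fin.sum_univ_two] at this
    simp [om1, om2, fr1, fr2, Fin.sum_univ_two]
    linarith

theorem nablaCov_eq (f : Pt → Fin 2 → ℝ) (i : Fin 2) (z v : Pt)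
    (h1 : (dX f z).det ≠ 0) (h2 : (dY f z).det ≠ 0) :
    nablaCov f i z v = ∑ j, (pT f i j z * om1 f j z v + qT f i j z * om2 f j z v) := by
  have e := expand f z v h1 h2
  have : nablaCov f i z v = nablaCov f i z
      (∑ j, (om1 f j z v • fr1 f j z + om2 f j z v • fr2 f j z)) := by rw [← e]
  rw [this]
  simp only [nablaCov, pT, qT, Fin.sum_univ_two, map_add, map_smul, conn_add, conn_smul,
    smul_eq_mul]
  ring

/-- `p = p_[12]`. -/
def pS (f : Pt → Fin 2 → ℝ) (z : Pt) : ℝ := (pT f 0 1 z - pT f 1 0 z) / 2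

/-- `q = q_[12]`. -/
def qS (f : Pt → Fin 2 → ℝ) (z : Pt) : ℝ := (qT f 0 1 z - qT f 1 0 z) / 2

/-- The curvature form `dωⱼⁱ - ωⱼᵏ ∧ ωₖⁱ` at `z`, evaluated on `(u, v)`. -/
def curvForm (f : Pt → Fin 2 → ℝ) (j i : Fin 2) (z u v : Pt) : ℝ :=
  fderiv ℝ (fun w => conn f j i w v) z u - fderiv ℝ (fun w => conn f j i w u) z v
    - ∑ k, (conn f j k z u * conn f k i z v - conn f j k z v * conn f k i z u)

/-- The curvature tensor `bⁱⱼₖₗ`: the coefficient of `ω₁ᵏ ∧ ω₂ˡ` in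
`dωⱼⁱ - ωⱼᵏ ∧ ωₖⁱ = bⁱⱼₖₗ ω₁ᵏ ∧ ω₂ˡ`. -/
def curv (f : Pt → Fin 2 → ℝ) (i j k l : Fin 2) (z : Pt) : ℝ :=
  curvForm f j i z (fr1 f k z) (fr2 f l z)

/-- The symmetric part `t_(jkl)`. -/
def sym3 (t : Fin 2 → Fin 2 → Fin 2 → ℝ) (j k l : Fin 2) : ℝ :=
  (t j k l + t j l k + t k j l + t k l j + t l j k + t l k j) / 6

/-- The web is not isoclinicly geodesic: `a ≠ 0`. -/
def NonIsoclinicGeodesic (f : Pt → Fin 2 → ℝ) (D : Set Pt) : Prop :=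
  ∀ z ∈ D, ∃ i, cov f i z ≠ 0

/-- The web is nonisoclinic: `p² + q² > 0`. -/
def NonIsoclinic (f : Pt → Fin 2 → ℝ) (D : Set Pt) : Prop :=
  ∀ z ∈ D, 0 < pS f z ^ 2 + qS f z ^ 2

/-- Analytic condition for group webs: the curvature tensor vanishes. -/
def CurvatureVanishes (f : Pt → Fin 2 → ℝ) (D : Set Pt) : Prop :=
  ∀ z ∈ D, ∀ i j k l, curv f i j k l z = 0

/-! ### Surfaces -/

/-- `Φ`, restricted to the open set `U`, is a smooth immersed parametrized surface in `D`. -/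
structure IsSurface (D : Set Pt) (U : Set (ℝ × ℝ)) (Φ : ℝ × ℝ → Pt) : Prop where
  isOpen : IsOpen U
  smooth : ContDiffOn ℝ ∞ Φ U
  mapsTo : ∀ u ∈ U, Φ u ∈ D
  immersion : ∀ u ∈ U, Function.Injective (fderiv ℝ Φ u)

/-- The tangent plane of a parametrized surface. -/
def tangentPlane (Φ : ℝ × ℝ → Pt) (u : ℝ × ℝ) : Set Pt := Set.range (fderiv ℝ Φ u)

/-- A surface in `D` that is tangent at each of its points to the distribution `P`. -/
structure IsIntegralSurface (D : Set Pt) (P : Pt → Set Pt) (U : Set (ℝ × ℝ))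
    (Φ : ℝ × ℝ → Pt) : Prop extends IsSurface D U Φ where
  tangent : ∀ u ∈ U, tangentPlane Φ u = P (Φ u)

/-- A distribution of planes is integrable on `D`: an integral surface passes through every
point of `D`. -/
def Integrable (D : Set Pt) (P : Pt → Set Pt) : Prop :=
  ∀ z ∈ D, ∃ (U : Set (ℝ × ℝ)) (Φ : ℝ × ℝ → Pt) (u : ℝ × ℝ),
    IsIntegralSurface D P U Φ ∧ u ∈ U ∧ Φ u = z

/-! ### Transversally geodesic webs -/

/-- The transversal bivector (plane) at `z` in the direction `ξ`:
`ξ² ω₁¹ - ξ¹ ω₁² = 0`, `ξ² ω₂¹ - ξ¹ ω₂² = 0`. -/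
def transversalPlane (f : Pt → Fin 2 → ℝ) (ξ : Fin 2 → ℝ) (z : Pt) : Set Pt :=
  {v | ξ 1 * om1 f 0 z v - ξ 0 * om1 f 1 z v = 0 ∧
    ξ 1 * om2 f 0 z v - ξ 0 * om2 f 1 z v = 0}

/-- The web is transversally geodesic: through every point and tangent to every transversal
bivector at this point there passes a surface whose tangent plane at each of its points
is a transversal bivector. (By the structure equations, such a surface is automatically totally
geodesic in the connection `ωⱼⁱ`.) -/
def TransversallyGeodesic (f : Pt → Fin 2 → ℝ) (D : Set Pt) : Prop :=
  ∀ z ∈ D, ∀ ξ : Fin 2 → ℝ, ξ ≠ 0 →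
    ∃ (U : Set (ℝ × ℝ)) (Φ : ℝ × ℝ → Pt) (u₀ : ℝ × ℝ),
      IsSurface D U Φ ∧ u₀ ∈ U ∧ Φ u₀ = z ∧ tangentPlane Φ u₀ = transversalPlane f ξ z ∧
      ∀ u ∈ U, ∃ η : Fin 2 → ℝ, η ≠ 0 ∧ tangentPlane Φ u = transversalPlane f η (Φ u)

/-- The analytic condition `bⁱ_(jkl) = δⁱ_(j b_kl)` for transversally geodesic webs. -/
def CurvatureTransversal (f : Pt → Fin 2 → ℝ) (D : Set Pt) : Prop :=
  ∀ z ∈ D, ∃ β : Fin 2 → Fin 2 → ℝ, ∀ i j k l,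
    sym3 (fun j k l => curv f i j k l z) j k l =
      sym3 (fun j k l => (if i = j then 1 else 0) * β k l) j k l

/-- Class **C**, nontransversally geodesic webs. Both the geometric property and the
analytic condition are required to fail. -/
structure ClassC (f : Pt → Fin 2 → ℝ) (D : Set Pt) : Prop where
  geometric : ¬ TransversallyGeodesic f D
  analytic : ¬ CurvatureTransversal f D

/-! ### The transversal `a`-distribution -/

/-- The transversal `a`-distribution `Δ`:
`a₁ ω₁¹ + a₂ ω₁² = 0`, `a₁ ω₂¹ + a₂ ω₂² = 0`. -/
def Delta (f : Pt → Fin 2 → ℝ) (z : Pt) : Set Pt :=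
  {v | ∑ i, cov f i z * om1 f i z v = 0 ∧ ∑ i, cov f i z * om2 f i z v = 0}

/-- The form `θⱼⁱ = ωⱼⁱ + aⁱⱼₖ (P ω₁ᵏ + Q ω₂ᵏ)` at `z`, evaluated on `v`; here `P, Q` are the
values at `z` of two arbitrary functions. -/
def theta (f : Pt → Fin 2 → ℝ) (P Q : ℝ) (j i : Fin 2) (z v : Pt) : ℝ :=
  conn f j i z v + ∑ k, torsion f i j k z * (P * om1 f k z v + Q * om2 f k z v)

/-- `ω₁ⁱ(∇_X V)` at `z`, for the connection given by `diag(θⱼⁱ, θⱼⁱ)`. -/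
def covDeriv1 (f : Pt → Fin 2 → ℝ) (P Q : ℝ) (V : Pt → Pt) (i : Fin 2) (z X : Pt) : ℝ :=
  fderiv ℝ (fun w => om1 f i w (V w)) z X + ∑ j, om1 f j z (V z) * theta f P Q j i z X

/-- `ω₂ⁱ(∇_X V)` at `z`, for the connection given by `diag(θⱼⁱ, θⱼⁱ)`. -/
def covDeriv2 (f : Pt → Fin 2 → ℝ) (P Q : ℝ) (V : Pt → Pt) (i : Fin 2) (z X : Pt) : ℝ :=
  fderiv ℝ (fun w => om2 f i w (V w)) z X + ∑ j, om2 f j z (V z) * theta f P Q j i z X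

/-- The integral surfaces of `Δ` are geodesicly parallel in every affine connection of the bundle
`diag(θⱼⁱ, θⱼⁱ)`: the distribution `Δ` of their tangent planes is parallel, that is,
`∇_X V` lies in `Δ` for every smooth section `V` of `Δ` and every vector `X`. -/
def GeodesiclyParallel (f : Pt → Fin 2 → ℝ) (D : Set Pt) : Prop :=
  ∀ (P Q : Pt → ℝ) (V : Pt → Pt), ContDiffOn ℝ ∞ V D → (∀ z ∈ D, V z ∈ Delta f z) →
    ∀ z ∈ D, ∀ X : Pt,
      ∑ i, cov f i z * covDeriv1 f (P z) (Q z) V i z X = 0 ∧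
      ∑ i, cov f i z * covDeriv2 f (P z) (Q z) V i z X = 0

/-- The two-dimensional three-web `W(3,2,1)` cut by the foliations `x = const`, `y = const`,
`f = const` on a parametrized surface is hexagonal: all sufficiently small hexagonal figures
close. In such a figure the vertices `A₁, A₄, A₇` lie on the leaf of the first foliation through
the centre `O`, `A₂, A₅` on the one of the second, `A₃, A₆` on the one of the third. -/
def HexagonalOn (f : Pt → Fin 2 → ℝ) (U : Set (ℝ × ℝ)) (Φ : ℝ × ℝ → Pt) : Prop :=
  ∀ u₀ ∈ U, ∃ W ∈ 𝓝 u₀, W ⊆ U ∧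
    ∀ O ∈ W, ∀ A₁ ∈ W, ∀ A₂ ∈ W, ∀ A₃ ∈ W, ∀ A₄ ∈ W, ∀ A₅ ∈ W, ∀ A₆ ∈ W, ∀ A₇ ∈ W,
      (Φ A₁).1 = (Φ O).1 →
      f (Φ A₂) = f (Φ A₁) → (Φ A₂).2 = (Φ O).2 →
      (Φ A₃).1 = (Φ A₂).1 → f (Φ A₃) = f (Φ O) →
      (Φ A₄).2 = (Φ A₃).2 → (Φ A₄).1 = (Φ O).1 →
      f (Φ A₅) = f (Φ A₄) → (Φ A₅).2 = (Φ O).2 →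
      (Φ A₆).1 = (Φ A₅).1 → f (Φ A₆) = f (Φ O) →
      (Φ A₇).2 = (Φ A₆).2 → (Φ A₇).1 = (Φ O).1 →
      A₇ = A₁

/-- Class **A₃**: nonisoclinic webs for which `Δ` is the distribution `ω₁² = ω₂² = 0` and is
integrable. Besides these geometric properties the analytic conditions `a₁ = 0`, `π₁² = 0`
(`π₁²` is the restriction of `ω₁²` to `ω_α^i = 0`) and `p₁₁ = q₁₁ = 0` are required. -/
structure ClassA3 (f : Pt → Fin 2 → ℝ) (D : Set Pt) : Prop where
  isWeb : IsWeb f D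
  cov_ne_zero : NonIsoclinicGeodesic f D
  nonIsoclinic : NonIsoclinic f D
  delta_eq : ∀ z ∈ D, Delta f z = {v | om1 f 1 z v = 0 ∧ om2 f 1 z v = 0}
  integrable : Integrable D (Delta f)
  cov_zero : ∀ z ∈ D, cov f 0 z = 0
  pi_zero : ∀ z ∈ D, ∀ v, (∀ i, om1 f i z v = 0 ∧ om2 f i z v = 0) → conn f 0 1 z v = 0
  pT_zero : ∀ z ∈ D, pT f 0 0 z = 0
  qT_zero : ∀ z ∈ D, qT f 0 0 z = 0

/-- Class **A₃₁**: webs of class **A₃** for which the integral surfaces of `Δ` are geodesicly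
parallel; the analytic condition `p₁ᵢ = q₁ᵢ = 0` is required as well. -/
structure ClassA31 (f : Pt → Fin 2 → ℝ) (D : Set Pt) : Prop extends ClassA3 f D where
  geodesiclyParallel : GeodesiclyParallel f D
  p1 : ∀ z ∈ D, ∀ i, pT f 0 i z = 0
  q1 : ∀ z ∈ D, ∀ i, qT f 0 i z = 0

/-- Class **A₃₂**: webs of class **A₃** foliated into two-dimensional hexagonal webs cut on
the integral surfaces of `Δ`; the analytic condition `b¹₁₁₁ = b²₁₁₁ = 0` is required as well. -/
structure ClassA32 (f : Pt → Fin 2 → ℝ) (D : Set Pt) : Prop extends ClassA3 f D where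
  hexagonal : ∀ (U : Set (ℝ × ℝ)) (Φ : ℝ × ℝ → Pt),
    IsIntegralSurface D (Delta f) U Φ → HexagonalOn f U Φ
  curv_zero : ∀ z ∈ D, ∀ i, curv f i 0 0 0 z = 0

/-- Class **E₃₂₁**: `p₁ᵢ = q₁ᵢ = 0`, `p₂₁ = q₂₁`, `p₂₂ = 0`. -/
structure ClassE321 (f : Pt → Fin 2 → ℝ) (D : Set Pt) : Prop where
  p1 : ∀ z ∈ D, ∀ i, pT f 0 i z = 0
  q1 : ∀ z ∈ D, ∀ i, qT f 0 i z = 0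
  p21 : ∀ z ∈ D, pT f 1 0 z = qT f 1 0 z
  p22 : ∀ z ∈ D, pT f 1 1 z = 0

/-- Class **G₃**: `p = q ≠ 0`. -/
def ClassG3 (f : Pt → Fin 2 → ℝ) (D : Set Pt) : Prop :=
  ∀ z ∈ D, pS f z = qS f z ∧ pS f z ≠ 0

/-- The web `u₃¹ = y² exp(x¹ y¹)`, `u₃² = x² + y²` (superscripts are indices). -/
def expWeb (z : Pt) : Fin 2 → ℝ :=
  ![z.2 1 * Real.exp (z.1 0 * z.2 0), z.1 1 + z.2 1]

end Web322

end

/-!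
Since `f² = x² + y²` is affine and involves only `x²` and `y²`, all `Γ²ⱼₖ` vanish, hence so do
`ωⱼ²`, `b²ⱼₖₗ` and `a₁`, and `Δ` is the distribution `dx² = dy² = 0`. On its leaves `y²` is
constant, so the three families become `x¹ = const`, `y¹ = const`, `x¹ y¹ = const`: this is a web
defined by the multiplication of a group, and therefore hexagonal.

If all tangent planes of a surface are transversal, they split into an `x`-direction and a
`y`-direction, so the surface is locally the product of a curve `x¹ = σ(x²)` and a curve
`y¹ = τ(y²)`. Transversality then reads `t (τ(t) σ'(s) - σ(s) τ'(t)) = 1`. If `σ` is not constant,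
this forces `τ' = c τ` and then `1 + c t = 0` for all `t` in an interval, which is absurd.
-/

noncomputable section

namespace Web322

open Real (exp)

variable {f : Pt → Fin 2 → ℝ} {D : Set Pt}

/-- The coordinate `xⁱ` on `ℝ⁴` as a linear form, which is also its differential. -/
def dx (i : Fin 2) : Pt →L[ℝ] ℝ :=
  (ContinuousLinearMap.proj i).comp (ContinuousLinearMap.fst ℝ (Fin 2 → ℝ) (Fin 2 → ℝ))

/-- The coordinate `yⁱ` on `ℝ⁴` as a linear form, which is also its differential. -/
def dy (i : Fin 2) : Pt →L[ℝ] ℝ :=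
  (ContinuousLinearMap.proj i).comp (ContinuousLinearMap.snd ℝ (Fin 2 → ℝ) (Fin 2 → ℝ))

@[simp] theorem dx_apply (i : Fin 2) (v : Pt) : dx i v = v.1 i := rfl

@[simp] theorem dy_apply (i : Fin 2) (v : Pt) : dy i v = v.2 i := rfl

theorem eventually_eq_of_hasFDerivAt_zero {P E F : Type*} [TopologicalSpace P]
    [NormedAddCommGroup E] [NormedSpace ℝ E] [NormedAddCommGroup F] [NormedSpace ℝ F]
    {K : P → E → F} {a : P} {b : E}
    (hK : ∀ᶠ p in 𝓝 (a, b), HasFDerivAt (K p.1) (0 : E →L[ℝ] F) p.2) :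
    ∀ᶠ p in 𝓝 (a, b), K p.1 p.2 = K p.1 b := by
  rw [nhds_prod_eq] at hK ⊢
  obtain ⟨S, hS, T, hT, h⟩ := Filter.eventually_prod_iff.1 hK
  obtain ⟨r, hr, hball⟩ := Metric.eventually_nhds_iff_ball.1 hT
  filter_upwards [hS.prod_mk (Metric.ball_mem_nhds b hr)] with p hp
  have hd : ∀ w ∈ Metric.ball b r, HasFDerivAt (K p.1) (0 : E →L[ℝ] F) w := fun w hw =>
    h hp.1 (hball w hw)
  exact Metric.isOpen_ball.is_const_of_fderiv_eq_zero (𝕜 := ℝ) (convex_ball b r).isPreconnected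
    (fun w hw => (hd w hw).differentiableAt.differentiableWithinAt)
    (fun w hw => (hd w hw).fderiv) hp.2 (Metric.mem_ball_self hr)

section ProductMaps

variable {E F : Type*} [NormedAddCommGroup E] [NormedSpace ℝ E] [NormedAddCommGroup F]
  [NormedSpace ℝ F] {G : ℝ × ℝ → E × F}

theorem hasDerivAt_of_hasFDerivAt_of_eventually_eq_prod {G' : ℝ × ℝ →L[ℝ] E × F} {X : ℝ → E}
    {Y : ℝ → F} {p : ℝ × ℝ} (hG : HasFDerivAt G G' p)
    (h : ∀ᶠ q in 𝓝 p, G q = (X q.1, Y q.2)) :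
    HasDerivAt X (G' (1, 0)).1 p.1 ∧ HasDerivAt Y (G' (0, 1)).2 p.2 := by
  have hX : HasDerivAt (fun t => (t, p.2)) ((1, 0) : ℝ × ℝ) p.1 :=
    (hasDerivAt_id _).prodMk (hasDerivAt_const _ _)
  have hY : HasDerivAt (fun t => (p.1, t)) ((0, 1) : ℝ × ℝ) p.2 :=
    (hasDerivAt_const _ _).prodMk (hasDerivAt_id _)
  constructor
  · refine (hG.fst.comp_hasDerivAt p.1 hX).congr_of_eventuallyEq ?_
    filter_upwards [hX.continuousAt.eventually h] with t ht using (congrArg Prod.fst ht).symm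
  · refine (hG.snd.comp_hasDerivAt p.2 hY).congr_of_eventuallyEq ?_
    filter_upwards [hY.continuousAt.eventually h] with t ht using (congrArg Prod.snd ht).symm

theorem eventually_eq_prod_of_hasFDerivAt {a b : ℝ}
    (hG : ∀ᶠ p in 𝓝 (a, b), ∃ G' : ℝ × ℝ →L[ℝ] E × F, HasFDerivAt G G' p ∧
      (G' (0, 1)).1 = 0 ∧ (G' (1, 0)).2 = 0) :
    ∀ᶠ p in 𝓝 (a, b), G p = ((G (p.1, b)).1, (G (a, p.2)).2) := by
  have hfst : ∀ᶠ p in 𝓝 (a, b), (G p).1 = (G (p.1, b)).1 := by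
    refine eventually_eq_of_hasFDerivAt_zero (K := fun s t => (G (s, t)).1) ?_
    filter_upwards [hG] with p ⟨G', hG', h0, _⟩
    have hcomp :=
      hG'.fst.comp_hasDerivAt p.2 ((hasDerivAt_const p.2 p.1).prodMk (hasDerivAt_id p.2))
    have hzero : HasDerivAt (fun t => (G (p.1, t)).1) 0 p.2 := hcomp.congr_deriv h0
    simpa using hzero.hasFDerivAt
  have hsnd : ∀ᶠ p in 𝓝 (b, a), (G p.swap).2 = (G (a, p.1)).2 := by
    refine eventually_eq_of_hasFDerivAt_zero (K := fun t s => (G (s, t)).2) ?_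
    filter_upwards [(continuous_swap.tendsto (b, a)).eventually hG] with p ⟨G', hG', _, h0⟩
    have hcomp :=
      hG'.snd.comp_hasDerivAt p.2 ((hasDerivAt_id p.2).prodMk (hasDerivAt_const p.2 p.1))
    have hzero : HasDerivAt (fun s => (G (s, p.1)).2) 0 p.2 := hcomp.congr_deriv h0
    simpa using hzero.hasFDerivAt
  filter_upwards [hfst, (continuous_swap.tendsto (a, b)).eventually hsnd] with p h₁ h₂
  exact Prod.ext h₁ h₂

end ProductMaps

theorem not_eventually_mul_sub_eq_one {σ σ' τ τ' : ℝ → ℝ} {a b : ℝ}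
    (hσ : HasDerivAt σ (σ' a) a) (hσ' : σ' a ≠ 0) (hτ : ∀ᶠ t in 𝓝 b, HasDerivAt τ (τ' t) t) :
    ¬ ∀ᶠ s in 𝓝 a, ∀ᶠ t in 𝓝 b, t * (τ t * σ' s - σ s * τ' t) = 1 := by
  intro h
  have ha := h.self_of_nhds
  obtain ⟨s, hs, hsσ⟩ :=
    ((h.filter_mono nhdsWithin_le_nhds).and (hσ.eventually_ne (c := σ a) hσ')).exists
  -- Subtracting the equations at `s` and at `a` gives `τ' = c τ`; the equation at `a` then says
  -- that `t τ` is constant, so that `τ + t τ' = (1 + c t) τ` vanishes.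
  obtain ⟨c, hc⟩ : ∃ c, c * (σ s - σ a) = σ' s - σ' a :=
    ⟨_, div_mul_cancel₀ _ (sub_ne_zero.2 hsσ)⟩
  have hτ' : ∀ᶠ t in 𝓝 b, τ' t = c * τ t := by
    filter_upwards [hs, ha] with t hst hat
    have ht : t ≠ 0 := by rintro rfl; simp at hat
    apply mul_left_cancel₀ (mul_ne_zero ht (sub_ne_zero.2 hsσ))
    linear_combination hat - hst - t * τ t * hc
  have hconst : ∀ᶠ t in 𝓝 b, t * τ t = (σ' a - c * σ a)⁻¹ := by
    filter_upwards [ha, hτ'] with t hat ht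
    refine eq_inv_of_mul_eq_one_left ?_
    rw [ht] at hat
    linear_combination hat
  have hlin : ∀ᶠ t in 𝓝 b, 1 + c * t = 0 := by
    filter_upwards [ha, hτ', hτ, hconst.eventually_nhds] with t hat ht hτt hct
    have hzero := ((hasDerivAt_id t).mul hτt).unique
      ((hasDerivAt_const t _).congr_of_eventuallyEq hct)
    have hτ0 : τ t ≠ 0 := by
      intro h0
      simp [ht, h0] at hat
    apply mul_left_cancel₀ hτ0
    rw [ht, id] at hzero
    linear_combination hzero
  obtain ⟨t, ht, htb⟩ :=
    ((hlin.filter_mono nhdsWithin_le_nhds).and eventually_mem_nhdsWithin).exists (f := 𝓝[≠] b)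
  have hc0 : c = 0 := by
    apply mul_right_cancel₀ (sub_ne_zero.2 htb)
    linear_combination ht - hlin.self_of_nhds
  simp [hc0] at ht

theorem eq_of_hexagon_mul_eq {R : Type*} [CommRing R] [IsDomain R] {x₀ x₂ x₅ y₀ y₁ y₄ y₇ : R}
    (hx₀ : x₀ ≠ 0) (hy₀ : y₀ ≠ 0) (h₁₂ : x₂ * y₀ = x₀ * y₁) (h₃ : x₂ * y₄ = x₀ * y₀)
    (h₄₅ : x₅ * y₀ = x₀ * y₄) (h₆ : x₅ * y₇ = x₀ * y₀) : y₇ = y₁ := by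
  have hx : x₅ * x₂ = x₀ * x₀ := by
    apply mul_right_cancel₀ hy₀
    linear_combination x₂ * h₄₅ + x₀ * h₃
  apply mul_left_cancel₀ (mul_ne_zero hx₀ hx₀)
  linear_combination x₂ * h₆ + x₀ * h₁₂ - y₇ * hx

section Surfaces

variable {U : Set (ℝ × ℝ)} {Φ : ℝ × ℝ → Pt} {u : ℝ × ℝ}

/-- Near `p`, the reparametrization `Φ ∘ g` is the product of the curves `X` in the `x`-plane and
`Y` in the `y`-plane, whose parameters are the coordinates `xⁱ` and `yʲ`. -/
structure IsProductAt (Φ : ℝ × ℝ → Pt) (g : ℝ × ℝ → ℝ × ℝ) (X Y : ℝ → Fin 2 → ℝ) (i j : Fin 2)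
    (p : ℝ × ℝ) : Prop where
  apply_eq : Φ (g p) = (X p.1, Y p.2)
  hasDerivAt_left : HasDerivAt X (deriv X p.1) p.1
  hasDerivAt_right : HasDerivAt Y (deriv Y p.2) p.2
  left_apply : X p.1 i = p.1
  right_apply : Y p.2 j = p.2
  deriv_left_apply : deriv X p.1 i = 1
  deriv_right_apply : deriv Y p.2 j = 1
  tangent_left : (deriv X p.1, 0) ∈ tangentPlane Φ (g p)
  tangent_right : (0, deriv Y p.2) ∈ tangentPlane Φ (g p)

theorem IsSurface.contDiffAt (hΦ : IsSurface D U Φ) (hu : u ∈ U) : ContDiffAt ℝ ∞ Φ u :=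
  hΦ.smooth.contDiffAt (hΦ.isOpen.mem_nhds hu)

theorem IsSurface.hasFDerivAt (hΦ : IsSurface D U Φ) (hu : u ∈ U) :
    HasFDerivAt Φ (fderiv ℝ Φ u) u :=
  ((hΦ.contDiffAt hu).differentiableAt (by simp)).hasFDerivAt

theorem IsSurface.eventually_apply_eq (hΦ : IsSurface D U Φ) (hu : u ∈ U) (L : Pt →L[ℝ] ℝ)
    (hL : ∀ w ∈ U, ∀ v ∈ tangentPlane Φ w, L v = 0) : ∀ᶠ w in 𝓝 u, L (Φ w) = L (Φ u) := by
  have hd : ∀ w ∈ U, HasFDerivAt (fun w => L (Φ w)) (0 : ℝ × ℝ →L[ℝ] ℝ) w := by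
    intro w hw
    have hzero : L.comp (fderiv ℝ Φ w) = 0 := ContinuousLinearMap.ext fun c => hL w hw _ ⟨c, rfl⟩
    exact hzero ▸ L.hasFDerivAt.comp w (hΦ.hasFDerivAt hw)
  exact ((continuous_const.prodMk continuous_id).tendsto u).eventually
    (eventually_eq_of_hasFDerivAt_zero (K := fun _ : Unit => fun w => L (Φ w)) (a := ())
      ((continuous_snd.tendsto _).eventually ((hΦ.isOpen.eventually_mem hu).mono hd)))

theorem IsSurface.exists_hasFDerivAt_equiv (hΦ : IsSurface D U Φ) (hu : u ∈ U)
    (π : Pt →L[ℝ] ℝ × ℝ) (hπ : ∀ v ∈ tangentPlane Φ u, π v = 0 → v = 0) :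
    ∃ e : (ℝ × ℝ) ≃L[ℝ] (ℝ × ℝ),
      HasFDerivAt (fun w => π (Φ w)) (e : (ℝ × ℝ) →L[ℝ] (ℝ × ℝ)) u := by
  have hd : HasFDerivAt (fun w => π (Φ w)) (π.comp (fderiv ℝ Φ u)) u :=
    π.hasFDerivAt.comp u (hΦ.hasFDerivAt hu)
  have hinj : Function.Injective (π.comp (fderiv ℝ Φ u)).toLinearMap := by
    refine (injective_iff_map_eq_zero _).2 fun c hc => hΦ.immersion u hu ?_
    rw [hπ _ ⟨c, rfl⟩ hc, map_zero]
  refine ⟨(LinearEquiv.ofInjectiveEndo _ hinj).toContinuousLinearEquiv, ?_⟩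
  convert hd using 1
  ext <;> rfl

theorem IsSurface.exists_nhds_injOn (hΦ : IsSurface D U Φ) (hu : u ∈ U)
    (π : Pt →L[ℝ] ℝ × ℝ) (hπ : ∀ v ∈ tangentPlane Φ u, π v = 0 → v = 0) :
    ∃ W ∈ 𝓝 u, Set.InjOn (fun w => π (Φ w)) W := by
  obtain ⟨e, he⟩ := hΦ.exists_hasFDerivAt_equiv hu π hπ
  have hsmooth : ContDiffAt ℝ ∞ (fun w => π (Φ w)) u :=
    π.contDiff.contDiffAt.comp u (hΦ.contDiffAt hu)
  let chart := hsmooth.toOpenPartialHomeomorph _ he (by simp)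
  exact ⟨chart.source,
    chart.open_source.mem_nhds (hsmooth.mem_toOpenPartialHomeomorph_source he (by simp)),
    chart.injOn⟩

theorem IsSurface.exists_localSection (hΦ : IsSurface D U Φ) (hu : u ∈ U)
    (π : Pt →L[ℝ] ℝ × ℝ) (hπ : ∀ v ∈ tangentPlane Φ u, π v = 0 → v = 0) :
    ∃ g : ℝ × ℝ → ℝ × ℝ, g (π (Φ u)) = u ∧ ∀ᶠ p in 𝓝 (π (Φ u)), g p ∈ U ∧ π (Φ (g p)) = p ∧
      ∃ G' : ℝ × ℝ →L[ℝ] Pt, HasFDerivAt (fun q => Φ (g q)) G' p ∧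
        Set.range G' = tangentPlane Φ (g p) ∧ ∀ c, π (G' c) = c := by
  obtain ⟨e, he⟩ := hΦ.exists_hasFDerivAt_equiv hu π hπ
  have hsmooth : ContDiffAt ℝ ∞ (fun w => π (Φ w)) u :=
    π.contDiff.contDiffAt.comp u (hΦ.contDiffAt hu)
  have hstrict := hsmooth.hasStrictFDerivAt' he (by simp)
  set g := hstrict.localInverse _ _ _
  have hg : ContDiffAt ℝ ∞ g (π (Φ u)) := hsmooth.to_localInverse he (by simp)
  refine ⟨g, hstrict.localInverse_apply_image, ?_⟩
  filter_upwards [hstrict.localInverse_tendsto.eventually (hΦ.isOpen.mem_nhds hu),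
    hstrict.eventually_right_inverse.eventually_nhds,
    (hg.of_le (by simp : (1 : WithTop ℕ∞) ≤ ∞)).eventually (by simp)] with p hpU hpinv hgp
  have hg' := (hgp.differentiableAt one_ne_zero).hasFDerivAt
  have hG' : HasFDerivAt (fun q => Φ (g q)) _ p := (hΦ.hasFDerivAt hpU).comp p hg'
  have hid : ∀ c, π (fderiv ℝ Φ (g p) (fderiv ℝ g p c)) = c := fun c =>
    DFunLike.congr_fun ((π.hasFDerivAt.comp p hG').unique
      ((hasFDerivAt_id p).congr_of_eventuallyEq hpinv)) c
  have hsurj : Function.Surjective (fderiv ℝ g p) :=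
    LinearMap.injective_iff_surjective.1 (Function.LeftInverse.injective
      (g := fun v => π (fderiv ℝ Φ (g p) v)) hid : Function.Injective (fderiv ℝ g p).toLinearMap)
  exact ⟨hpU, hpinv.self_of_nhds, _, hG', hsurj.range_comp _, hid⟩

theorem fst_snd_eq_zero_of_range_split {i j : Fin 2} {A : ℝ × ℝ →L[ℝ] Pt}
    (hA : ∀ c, (dx i).prod (dy j) (A c) = c) (hsplit : ∀ c, ((A c).1, 0) ∈ Set.range A) :
    (A (0, 1)).1 = 0 ∧ (A (1, 0)).2 = 0 := by
  have hfst : ∀ c : ℝ × ℝ, A (c.1, 0) = ((A c).1, 0) := by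
    intro c
    obtain ⟨d, hd⟩ := hsplit c
    have hc : (A c).1 i = c.1 := congrArg Prod.fst (hA c)
    have hdc : d = (c.1, 0) := by
      rw [← hA d, hd]
      exact Prod.ext hc rfl
    rw [← hd, hdc]
  have h₀₁ := hfst (0, 1)
  rw [Prod.mk_zero_zero, map_zero] at h₀₁
  exact ⟨(congrArg Prod.fst h₀₁).symm, congrArg Prod.snd (hfst (1, 0))⟩

theorem IsSurface.exists_eq_prod_curves (hΦ : IsSurface D U Φ) (hu : u ∈ U) (i j : Fin 2)
    (hsplit : ∀ w ∈ U, ∀ v ∈ tangentPlane Φ w, (v.1, 0) ∈ tangentPlane Φ w)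
    (hinj : ∀ v ∈ tangentPlane Φ u, v.1 i = 0 → v.2 j = 0 → v = 0) :
    ∃ (g : ℝ × ℝ → ℝ × ℝ) (X Y : ℝ → Fin 2 → ℝ), g ((Φ u).1 i, (Φ u).2 j) = u ∧
      ∀ᶠ p in 𝓝 ((Φ u).1 i, (Φ u).2 j), g p ∈ U ∧ IsProductAt Φ g X Y i j p := by
  obtain ⟨g, hgu, hg⟩ := hΦ.exists_localSection hu ((dx i).prod (dy j))
    fun v hv h0 => hinj v hv (congrArg Prod.fst h0) (congrArg Prod.snd h0)
  set a := (Φ u).1 i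
  set b := (Φ u).2 j
  change ∀ᶠ p in 𝓝 (a, b), _ at hg
  have hcross : ∀ p, g p ∈ U → ∀ G' : ℝ × ℝ →L[ℝ] Pt, Set.range G' = tangentPlane Φ (g p) →
      (∀ c, (dx i).prod (dy j) (G' c) = c) → (G' (0, 1)).1 = 0 ∧ (G' (1, 0)).2 = 0 :=
    fun p hp G' hrange hcoord => fst_snd_eq_zero_of_range_split hcoord fun c =>
      hrange ▸ hsplit _ hp _ (hrange ▸ Set.mem_range_self c)
  have hprod := eventually_eq_prod_of_hasFDerivAt (hg.mono fun p ⟨hp, _, G', hG', hrange, hid⟩ =>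
    ⟨G', hG', hcross p hp G' hrange hid⟩)
  let X := fun s => (Φ (g (s, b))).1
  let Y := fun t => (Φ (g (a, t))).2
  refine ⟨g, X, Y, hgu, ?_⟩
  filter_upwards [hg, hprod.eventually_nhds] with p ⟨hp, hcoord, G', hG', hrange, hid⟩ hpr
  obtain ⟨hX, hY⟩ := hasDerivAt_of_hasFDerivAt_of_eventually_eq_prod (X := X) (Y := Y) hG' hpr
  obtain ⟨h₀₁, h₁₀⟩ := hcross p hp G' hrange hid
  have happly := hpr.self_of_nhds
  rw [happly] at hcoord
  refine ⟨hp, happly, hX.differentiableAt.hasDerivAt, hY.differentiableAt.hasDerivAt,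
    congrArg Prod.fst hcoord, congrArg Prod.snd hcoord, ?_, ?_, ?_, ?_⟩
  · exact hX.deriv ▸ congrArg Prod.fst (hid (1, 0))
  · exact hY.deriv ▸ congrArg Prod.snd (hid (0, 1))
  · exact hrange ▸ ⟨(1, 0), Prod.ext hX.deriv.symm h₁₀⟩
  · exact hrange ▸ ⟨(0, 1), Prod.ext h₀₁ hY.deriv.symm⟩

end Surfaces

theorem integrable_of_eq_range (hD : IsOpen D) {P : Pt → Set Pt} {L : ℝ × ℝ →L[ℝ] Pt}
    (hL : Function.Injective L) (hP : ∀ z ∈ D, P z = Set.range L) : Integrable D P := by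
  intro z hz
  have hd : ∀ u, fderiv ℝ (fun u => z + L u) u = L := fun u => (L.hasFDerivAt.const_add z).fderiv
  have hsmooth : ContDiff ℝ ∞ fun u => z + L u := contDiff_const.add L.contDiff
  refine ⟨(fun u => z + L u) ⁻¹' D, fun u => z + L u, 0, ?_, by simpa using hz, by simp⟩
  exact
    { isOpen := hD.preimage hsmooth.continuous
      smooth := hsmooth.contDiffOn
      mapsTo := fun _ hu => hu
      immersion := fun u _ => (hd u).symm ▸ hL
      tangent := fun u hu => by rw [tangentPlane, hd, hP _ hu] }

theorem hexagonalOn_of_mul_eq_mul {R : Type*} [CommRing R] [IsDomain R] {s t : (Fin 2 → ℝ) → R}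
    {U : Set (ℝ × ℝ)} {Φ : ℝ × ℝ → Pt}
    (h : ∀ u ∈ U, ∃ W ∈ 𝓝 u, W ⊆ U ∧ Set.InjOn (fun A => (s (Φ A).1, t (Φ A).2)) W ∧
      (∀ A ∈ W, s (Φ A).1 ≠ 0 ∧ t (Φ A).2 ≠ 0) ∧
      ∀ A ∈ W, ∀ B ∈ W, f (Φ A) = f (Φ B) → s (Φ A).1 * t (Φ A).2 = s (Φ B).1 * t (Φ B).2) :
    HexagonalOn f U Φ := by
  intro u hu
  obtain ⟨W, hW, hWU, hinj, hne, hmul⟩ := h u hu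
  refine ⟨W, hW, hWU, ?_⟩
  intro O hO A₁ h₁ A₂ h₂ A₃ h₃ A₄ h₄ A₅ h₅ A₆ h₆ A₇ h₇ e₁ f₂ e₂ e₃ f₃ e₄ e₄' f₅ e₅ e₆ f₆ e₇ e₇'
  have m₂ := hmul _ h₂ _ h₁ f₂
  have m₃ := hmul _ h₃ _ hO f₃
  have m₅ := hmul _ h₅ _ h₄ f₅
  have m₆ := hmul _ h₆ _ hO f₆
  rw [e₁, e₂] at m₂
  rw [e₃, ← e₄] at m₃
  rw [e₄', e₅] at m₅
  rw [e₆, ← e₇] at m₆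
  refine hinj h₇ h₁ (Prod.ext (congrArg s (e₇'.trans e₁.symm)) ?_)
  exact eq_of_hexagon_mul_eq (hne O hO).1 (hne O hO).2 m₂ m₃ m₅ m₆

theorem fst_mem_transversalPlane {ξ : Fin 2 → ℝ} {z v : Pt} (hv : v ∈ transversalPlane f ξ z) :
    (v.1, 0) ∈ transversalPlane f ξ z :=
  ⟨hv.1, by simp [om2]⟩

section

variable {i : Fin 2} {z : Pt}

theorem conn_eq_zero (hΓ : ∀ j k, Gam f i j k z = 0) (j : Fin 2) (v : Pt) :
    conn f j i z v = 0 := by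
  simp [conn, hΓ]

theorem torsion_eq_zero (hΓ : ∀ j k, Gam f i j k z = 0) (j k : Fin 2) : torsion f i j k z = 0 := by
  simp [torsion, hΓ]

theorem curv_eq_zero (hΓ : ∀ᶠ w in 𝓝 z, ∀ j k, Gam f i j k w = 0) (j k l : Fin 2) :
    curv f i j k l z = 0 := by
  have hd : ∀ v, fderiv ℝ (fun w => conn f j i w v) z = 0 := fun v => by
    rw [Filter.EventuallyEq.fderiv_eq (hΓ.mono fun w hw => conn_eq_zero hw j v)]
    simp
  simp [curv, curvForm, hd, conn_eq_zero hΓ.self_of_nhds]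

theorem cov_zero_eq_zero (hΓ : ∀ j k, Gam f 1 j k z = 0) : cov f 0 z = 0 := by
  simp [cov, Fin.sum_univ_two, torsion, hΓ]

theorem nablaCov_zero_eq_zero (hΓ : ∀ᶠ w in 𝓝 z, ∀ j k, Gam f 1 j k w = 0) (v : Pt) :
    nablaCov f 0 z v = 0 := by
  have hd : fderiv ℝ (cov f 0) z = 0 := by
    rw [Filter.EventuallyEq.fderiv_eq (hΓ.mono fun w hw => cov_zero_eq_zero hw)]
    simp
  simp [nablaCov, hd, Fin.sum_univ_two, cov_zero_eq_zero hΓ.self_of_nhds,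
    conn_eq_zero hΓ.self_of_nhds]

theorem Delta_eq_of_cov_zero_eq_zero (h₀ : cov f 0 z = 0) (h₁ : cov f 1 z ≠ 0) :
    Delta f z = {v | om1 f 1 z v = 0 ∧ om2 f 1 z v = 0} := by
  simp [Delta, Fin.sum_univ_two, h₀, h₁]

theorem curvForm_zero_zero_eq_zero {φ : Pt → ℝ} (hφ : ContDiffAt ℝ 2 φ z)
    (hconn : ∀ᶠ w in 𝓝 z, ∀ v, conn f 0 0 w v = fderiv ℝ φ w v)
    (h₀ : ∀ v, conn f 0 1 z v = 0) (u v : Pt) : curvForm f 0 0 z u v = 0 := by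
  have hφ' : DifferentiableAt ℝ (fderiv ℝ φ) z :=
    (hφ.fderiv_right (m := 1) le_rfl).differentiableAt one_ne_zero
  have hd : ∀ a b, fderiv ℝ (fun w => conn f 0 0 w a) z b = fderiv ℝ (fderiv ℝ φ) z b a := by
    intro a b
    rw [Filter.EventuallyEq.fderiv_eq (hconn.mono fun w hw => hw a), fderiv_clm_apply hφ'
      (differentiableAt_const a)]
    simp
  have hsymm := (hφ.isSymmSndFDerivAt (by simp)).eq u v
  simp only [curvForm, hd, hsymm, Fin.sum_univ_two, h₀]
  ring

theorem CurvatureTransversal.sym3_curv_eq_zero (h : CurvatureTransversal f D) (hz : z ∈ D)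
    (hcurv : ∀ j k l, curv f 1 j k l z = 0) : sym3 (fun j k l => curv f 0 j k l z) 0 0 1 = 0 := by
  obtain ⟨β, hβ⟩ := h z hz
  have hβ₁ : β 0 1 + β 1 0 = 0 := by
    have h₁ := hβ 1 0 1 1
    simp only [sym3, hcurv, add_zero, zero_div, one_ne_zero, ↓reduceIte, zero_mul, one_mul,
      zero_add] at h₁
    linarith
  rw [hβ]
  simp only [sym3, ↓reduceIte, one_mul, zero_ne_one, zero_mul, add_zero, div_eq_zero_iff,
    OfNat.ofNat_ne_zero, or_false]
  linarith

end

theorem geodesiclyParallel_of_Gam_one_eq_zero (hf : IsWeb f D)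
    (hΓ : ∀ z ∈ D, ∀ j k, Gam f 1 j k z = 0) (hcov : ∀ z ∈ D, cov f 1 z ≠ 0) :
    GeodesiclyParallel f D := by
  intro P Q V _ hV z hz X
  have hV' : ∀ w ∈ D, om1 f 1 w (V w) = 0 ∧ om2 f 1 w (V w) = 0 := fun w hw =>
    (Delta_eq_of_cov_zero_eq_zero (cov_zero_eq_zero (hΓ w hw)) (hcov w hw)).subset (hV w hw)
  have hnhds := hf.isOpen.mem_nhds hz
  have hd₁ : fderiv ℝ (fun w => om1 f 1 w (V w)) z = 0 := by
    rw [(Filter.eventuallyEq_of_mem hnhds fun w hw => (hV' w hw).1).fderiv_eq]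
    simp
  have hd₂ : fderiv ℝ (fun w => om2 f 1 w (V w)) z = 0 := by
    rw [(Filter.eventuallyEq_of_mem hnhds fun w hw => (hV' w hw).2).fderiv_eq]
    simp
  simp [Fin.sum_univ_two, cov_zero_eq_zero (hΓ z hz), covDeriv1, covDeriv2, theta,
    conn_eq_zero (hΓ z hz), torsion_eq_zero (hΓ z hz), hd₁, hd₂]

theorem classA31_of_Gam_one_eq_zero (hf : IsWeb f D) (hΓ : ∀ z ∈ D, ∀ j k, Gam f 1 j k z = 0)
    (hcov : ∀ z ∈ D, cov f 1 z ≠ 0) (hpq : NonIsoclinic f D) (hΔ : Integrable D (Delta f)) :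
    ClassA31 f D := by
  have hnabla : ∀ z ∈ D, ∀ v, nablaCov f 0 z v = 0 := fun z hz =>
    nablaCov_zero_eq_zero ((hf.isOpen.eventually_mem hz).mono hΓ)
  have hcov₀ : ∀ z ∈ D, cov f 0 z = 0 := fun z hz => cov_zero_eq_zero (hΓ z hz)
  exact
    { isWeb := hf
      cov_ne_zero := fun z hz => ⟨1, hcov z hz⟩
      nonIsoclinic := hpq
      delta_eq := fun z hz => Delta_eq_of_cov_zero_eq_zero (hcov₀ z hz) (hcov z hz)
      integrable := hΔ
      cov_zero := hcov₀
      pi_zero := fun z hz v _ => conn_eq_zero (hΓ z hz) 0 v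
      pT_zero := fun z hz => hnabla z hz _
      qT_zero := fun z hz => hnabla z hz _
      geodesiclyParallel := geodesiclyParallel_of_Gam_one_eq_zero hf hΓ hcov
      p1 := fun z hz _ => hnabla z hz _
      q1 := fun z hz _ => hnabla z hz _ }

/-- The locus where `expWeb` is a three-web, that is, where `∂f/∂x` and `∂f/∂y` are invertible. -/
def regularSet : Set Pt := {z | z.1 0 ≠ 0 ∧ z.2 0 ≠ 0 ∧ z.2 1 ≠ 0}

theorem isOpen_regularSet : IsOpen regularSet := by
  refine .inter ?_ (.inter ?_ ?_) <;> exact isOpen_ne_fun (by fun_prop) (by fun_prop)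

section ExpWeb

variable {z : Pt}

theorem hasFDerivAt_x (i : Fin 2) (z : Pt) : HasFDerivAt (fun w : Pt => w.1 i) (dx i) z :=
  (dx i).hasFDerivAt

theorem hasFDerivAt_y (i : Fin 2) (z : Pt) : HasFDerivAt (fun w : Pt => w.2 i) (dy i) z :=
  (dy i).hasFDerivAt

theorem hasFDerivAt_exp_mul (z : Pt) :
    HasFDerivAt (fun w : Pt => exp (w.1 0 * w.2 0))
      (exp (z.1 0 * z.2 0) • (z.1 0 • dy 0 + z.2 0 • dx 0)) z :=
  ((hasFDerivAt_x 0 z).mul (hasFDerivAt_y 0 z)).exp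

theorem contDiff_expWeb : ContDiff ℝ ∞ expWeb := by
  refine contDiff_pi.2 (Fin.forall_fin_two.2 ⟨?_, ?_⟩)
  · change ContDiff ℝ ∞ fun z : Pt => z.2 1 * exp (z.1 0 * z.2 0)
    fun_prop
  · change ContDiff ℝ ∞ fun z : Pt => z.1 1 + z.2 1
    fun_prop

theorem fderiv_expWeb (z v : Pt) :
    fderiv ℝ expWeb z v =
      ![exp (z.1 0 * z.2 0) * (z.2 1 * (z.1 0 * v.2 0 + z.2 0 * v.1 0) + v.2 1),
        v.1 1 + v.2 1] := by
  have h : HasFDerivAt expWeb (.pi ![z.2 1 • exp (z.1 0 * z.2 0) • (z.1 0 • dy 0 + z.2 0 • dx 0) +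
      exp (z.1 0 * z.2 0) • dy 1, dx 1 + dy 1]) z :=
    hasFDerivAt_pi.2 (Fin.forall_fin_two.2
      ⟨(hasFDerivAt_y 1 z).mul (hasFDerivAt_exp_mul z),
        (hasFDerivAt_x 1 z).add (hasFDerivAt_y 1 z)⟩)
  rw [h.fderiv]
  ext i
  fin_cases i
  · simp only [smul_add, Fin.zero_eta, ContinuousLinearMap.coe_pi', Matrix.cons_val_zero, add_apply,
      smul_apply, dy_apply, smul_eq_mul, dx_apply]
    ring
  · simp

theorem dX_expWeb (z : Pt) : dX expWeb z = !![exp (z.1 0 * z.2 0) * z.2 1 * z.2 0, 0; 0, 1] := by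
  ext i j
  fin_cases i <;> fin_cases j <;> simp [dX, fderiv_expWeb, mul_assoc]

theorem dY_expWeb (z : Pt) :
    dY expWeb z = !![exp (z.1 0 * z.2 0) * z.2 1 * z.1 0, exp (z.1 0 * z.2 0); 0, 1] := by
  ext i j
  fin_cases i <;> fin_cases j <;> simp [dY, fderiv_expWeb, mul_assoc]

theorem inv_dX_expWeb (hz : z ∈ regularSet) :
    (dX expWeb z)⁻¹ = !![(exp (z.1 0 * z.2 0) * z.2 1 * z.2 0)⁻¹, 0; 0, 1] := by
  obtain ⟨-, hy₁, hy₂⟩ := hz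
  apply Matrix.inv_eq_right_inv
  rw [dX_expWeb, Matrix.mul_fin_two, Matrix.one_fin_two]
  field_simp
  simp

theorem inv_dY_expWeb (hz : z ∈ regularSet) :
    (dY expWeb z)⁻¹ = !![(exp (z.1 0 * z.2 0) * z.2 1 * z.1 0)⁻¹, -(z.2 1 * z.1 0)⁻¹; 0, 1] := by
  obtain ⟨hx₁, -, hy₂⟩ := hz
  apply Matrix.inv_eq_right_inv
  rw [dY_expWeb, Matrix.mul_fin_two, Matrix.one_fin_two]
  field_simp
  simp [hx₁, hy₂]

theorem isWeb_expWeb (hD : IsOpen D) (hsub : D ⊆ regularSet) : IsWeb expWeb D where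
  isOpen := hD
  smooth := contDiff_expWeb.contDiffOn
  det_dX z hz := by
    obtain ⟨-, hy₁, hy₂⟩ := hsub hz
    simp [dX_expWeb, Matrix.det_fin_two, hy₁, hy₂]
  det_dY z hz := by
    obtain ⟨hx₁, -, hy₂⟩ := hsub hz
    simp [dY_expWeb, Matrix.det_fin_two, hx₁, hy₂]

theorem om1_expWeb_zero (z v : Pt) :
    om1 expWeb 0 z v = exp (z.1 0 * z.2 0) * z.2 1 * z.2 0 * v.1 0 := by
  simp [om1, dX_expWeb, Fin.sum_univ_two]

theorem om1_expWeb_one (z v : Pt) : om1 expWeb 1 z v = v.1 1 := by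
  simp [om1, dX_expWeb, Fin.sum_univ_two]

theorem om2_expWeb_zero (z v : Pt) :
    om2 expWeb 0 z v = exp (z.1 0 * z.2 0) * (z.2 1 * z.1 0 * v.2 0 + v.2 1) := by
  simp only [om2, dY_expWeb, Fin.sum_univ_two, Matrix.of_apply, Matrix.cons_val]
  ring

theorem om2_expWeb_one (z v : Pt) : om2 expWeb 1 z v = v.2 1 := by
  simp [om2, dY_expWeb, Fin.sum_univ_two]

theorem fr1_expWeb_zero (hz : z ∈ regularSet) :
    fr1 expWeb 0 z = (![(exp (z.1 0 * z.2 0) * z.2 1 * z.2 0)⁻¹, 0], 0) := by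
  ext i <;> fin_cases i <;> simp [fr1, inv_dX_expWeb hz]

theorem fr1_expWeb_one (hz : z ∈ regularSet) : fr1 expWeb 1 z = (![0, 1], 0) := by
  ext i <;> fin_cases i <;> simp [fr1, inv_dX_expWeb hz]

theorem fr2_expWeb_zero (hz : z ∈ regularSet) :
    fr2 expWeb 0 z = (0, ![(exp (z.1 0 * z.2 0) * z.2 1 * z.1 0)⁻¹, 0]) := by
  ext i <;> fin_cases i <;> simp [fr2, inv_dY_expWeb hz]

theorem fderiv_dY_expWeb_zero_zero (z v : Pt) :
    fderiv ℝ (fun w => dY expWeb w 0 0) z v =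
      exp (z.1 0 * z.2 0) * (z.2 1 * v.1 0 + z.1 0 * v.2 1
        + z.1 0 * z.2 1 * (z.1 0 * v.2 0 + z.2 0 * v.1 0)) := by
  have h := ((hasFDerivAt_exp_mul z).fun_mul (hasFDerivAt_y 1 z)).fun_mul (hasFDerivAt_x 0 z)
  simp only [dY_expWeb, Matrix.of_apply, Matrix.cons_val, h.fderiv]
  simp only [smul_add, add_apply, smul_apply, dx_apply, smul_eq_mul, dy_apply]
  ring

theorem fderiv_dY_expWeb_zero_one (z v : Pt) :
    fderiv ℝ (fun w => dY expWeb w 0 1) z v =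
      exp (z.1 0 * z.2 0) * (z.1 0 * v.2 0 + z.2 0 * v.1 0) := by
  simp [dY_expWeb, (hasFDerivAt_exp_mul z).fderiv, mul_add]

theorem mixed_expWeb_zero_zero_zero (z : Pt) :
    mixed expWeb 0 0 0 z = exp (z.1 0 * z.2 0) * z.2 1 * (1 + z.1 0 * z.2 0) := by
  rw [mixed, fderiv_dY_expWeb_zero_zero]
  simp only [Pi.single_eq_same, mul_one, Pi.zero_apply, mul_zero, add_zero, zero_add]
  ring

theorem mixed_expWeb_zero_zero_one (z : Pt) :
    mixed expWeb 0 0 1 z = exp (z.1 0 * z.2 0) * z.2 0 := by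
  simp [mixed, fderiv_dY_expWeb_zero_one]

theorem mixed_expWeb_zero_one (m : Fin 2) (z : Pt) : mixed expWeb 0 1 m z = 0 := by
  fin_cases m <;> simp [mixed, fderiv_dY_expWeb_zero_zero, fderiv_dY_expWeb_zero_one]

theorem mixed_expWeb_one (l m : Fin 2) (z : Pt) : mixed expWeb 1 l m z = 0 := by
  fin_cases m <;> simp [mixed, dY_expWeb]

theorem Gam_expWeb_one (j k : Fin 2) (z : Pt) : Gam expWeb 1 j k z = 0 := by
  simp [Gam, mixed_expWeb_one]

theorem Gam_expWeb_zero_one (hz : z ∈ regularSet) (k : Fin 2) : Gam expWeb 0 1 k z = 0 := by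
  simp [Gam, Fin.sum_univ_two, mixed_expWeb_zero_one, inv_dX_expWeb hz]

theorem Gam_expWeb_zero_zero_zero (hz : z ∈ regularSet) :
    Gam expWeb 0 0 0 z =
      -(1 + z.1 0 * z.2 0) / (exp (z.1 0 * z.2 0) * z.1 0 * z.2 0 * z.2 1) := by
  have ⟨hx₁, hy₁, hy₂⟩ := hz
  simp only [Gam, inv_dX_expWeb hz, mul_inv_rev, Matrix.of_apply, Matrix.cons_val',
    Matrix.cons_val_zero, Matrix.cons_val_fin_one, inv_dY_expWeb hz, Fin.sum_univ_two,
    Matrix.cons_val_one, mul_zero, add_zero, mixed_expWeb_zero_zero_zero, mixed_expWeb_zero_one,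
    zero_mul, neg_add_rev]
  field_simp
  ring

theorem Gam_expWeb_zero_zero_one (hz : z ∈ regularSet) :
    Gam expWeb 0 0 1 z = (z.1 0 * z.2 0 * z.2 1)⁻¹ := by
  have ⟨hx₁, hy₁, hy₂⟩ := hz
  simp only [Gam, inv_dX_expWeb hz, mul_inv_rev, Matrix.of_apply, Matrix.cons_val',
    Matrix.cons_val_zero, Matrix.cons_val_fin_one, inv_dY_expWeb hz, Matrix.cons_val_one,
    Fin.sum_univ_two, mul_neg, mul_one, mixed_expWeb_zero_zero_zero, mixed_expWeb_zero_zero_one,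
    mixed_expWeb_zero_one, mul_zero, zero_mul, neg_zero, add_zero, neg_add_rev, neg_neg]
  field_simp
  ring

theorem cov_expWeb_one (hz : z ∈ regularSet) :
    cov expWeb 1 z = -(z.1 0 * z.2 0 * z.2 1)⁻¹ := by
  simp only [cov, torsion, Fin.sum_univ_two, Gam_expWeb_zero_one hz, Gam_expWeb_zero_zero_one hz,
    mul_inv_rev, zero_sub, Gam_expWeb_one, sub_self, zero_div, add_zero]
  ring

theorem cov_expWeb_one_ne_zero (hz : z ∈ regularSet) : cov expWeb 1 z ≠ 0 := by
  have ⟨hx₁, hy₁, hy₂⟩ := hz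
  simp [cov_expWeb_one hz, hx₁, hy₁, hy₂]

theorem conn_expWeb_zero_zero (hz : z ∈ regularSet) (v : Pt) :
    conn expWeb 0 0 z v = -(((z.1 0)⁻¹ + z.2 0) * v.1 0 + ((z.2 0)⁻¹ + z.1 0) * v.2 0
      + (z.2 1)⁻¹ * v.2 1) := by
  have ⟨hx₁, hy₁, hy₂⟩ := hz
  simp only [conn, Fin.sum_univ_two, Gam_expWeb_zero_zero_zero hz, neg_add_rev, om1_expWeb_zero,
    om2_expWeb_zero, Gam_expWeb_zero_one hz, zero_mul, Gam_expWeb_zero_zero_one hz, mul_inv_rev,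
    om2_expWeb_one, zero_add]
  field_simp
  ring

theorem conn_expWeb_one_zero (hz : z ∈ regularSet) (v : Pt) :
    conn expWeb 1 0 z v = exp (z.1 0 * z.2 0) * (z.1 0)⁻¹ * v.1 0 := by
  have ⟨hx₁, hy₁, hy₂⟩ := hz
  simp only [conn, Gam_expWeb_zero_one hz, zero_mul, add_zero, Fin.sum_univ_two,
    Gam_expWeb_zero_zero_one hz, mul_inv_rev, om1_expWeb_zero]
  field_simp

theorem nablaCov_expWeb_one (hz : z ∈ regularSet) (v : Pt) :
    nablaCov expWeb 1 z v = (z.1 0 * z.2 0 * z.2 1)⁻¹ *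
      ((z.1 0)⁻¹ * v.1 0 + (z.2 0)⁻¹ * v.2 0 + (z.2 1)⁻¹ * v.2 1) := by
  have ⟨hx₁, hy₁, hy₂⟩ := hz
  have h : HasFDerivAt (cov expWeb 1) _ z :=
    (HasFDerivAt.fun_neg ((hasDerivAt_inv (by simp [hx₁, hy₁, hy₂])).comp_hasFDerivAt z
      (((hasFDerivAt_x 0 z).mul (hasFDerivAt_y 0 z)).mul (hasFDerivAt_y 1 z)))
      ).congr_of_eventuallyEq
      (Filter.eventuallyEq_of_mem (isOpen_regularSet.mem_nhds hz) fun w hw => cov_expWeb_one hw)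
  rw [nablaCov, h.fderiv]
  simp only [Pi.mul_apply, smul_add, neg_smul, neg_add_rev, neg_neg, add_apply, smul_apply,
    dx_apply, smul_eq_mul, dy_apply, Fin.sum_univ_two, Gam_expWeb_one, implies_true,
    cov_zero_eq_zero, zero_mul, conn_eq_zero, mul_zero, add_zero, sub_zero, mul_inv_rev]
  field_simp

theorem pT_expWeb_one_zero (hz : z ∈ regularSet) :
    pT expWeb 1 0 z = (exp (z.1 0 * z.2 0))⁻¹ * ((z.1 0 * z.2 0 * z.2 1) ^ 2)⁻¹ := by
  have ⟨hx₁, hy₁, hy₂⟩ := hz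
  simp only [pT, fr1_expWeb_zero hz, mul_inv_rev, nablaCov_expWeb_one hz, Matrix.cons_val_zero,
    Pi.zero_apply, mul_zero, add_zero]
  field_simp

theorem qT_expWeb_one_zero (hz : z ∈ regularSet) :
    qT expWeb 1 0 z = (exp (z.1 0 * z.2 0))⁻¹ * ((z.1 0 * z.2 0 * z.2 1) ^ 2)⁻¹ := by
  have ⟨hx₁, hy₁, hy₂⟩ := hz
  simp only [qT, fr2_expWeb_zero hz, mul_inv_rev, nablaCov_expWeb_one hz, Pi.zero_apply, mul_zero,
    Matrix.cons_val_zero, zero_add, Matrix.cons_val_one, Matrix.cons_val_fin_one, add_zero]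
  field_simp

theorem pT_expWeb_one_one (hz : z ∈ regularSet) : pT expWeb 1 1 z = 0 := by
  simp [pT, nablaCov_expWeb_one hz, fr1_expWeb_one hz]

theorem fderiv_conn_expWeb_one_zero (hz : z ∈ regularSet) (u v : Pt) :
    fderiv ℝ (fun w => conn expWeb 1 0 w v) z u =
      exp (z.1 0 * z.2 0) *
        (u.2 0 + z.2 0 * (z.1 0)⁻¹ * u.1 0 - (z.1 0 ^ 2)⁻¹ * u.1 0) * v.1 0 := by
  have hx₁ : z.1 0 ≠ 0 := hz.1
  have h : HasFDerivAt (fun w => conn expWeb 1 0 w v) _ z :=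
    (((hasFDerivAt_exp_mul z).mul ((hasDerivAt_inv hx₁).comp_hasFDerivAt z
      (hasFDerivAt_x 0 z))).mul_const (v.1 0)).congr_of_eventuallyEq
      (Filter.eventuallyEq_of_mem (isOpen_regularSet.mem_nhds hz) fun w hw =>
        conn_expWeb_one_zero hw v)
  rw [h.fderiv]
  simp only [neg_smul, smul_neg, Function.comp_apply, smul_add, add_apply, neg_apply, smul_apply,
    dx_apply, smul_eq_mul, dy_apply]
  field_simp
  ring

theorem curvForm_expWeb_zero_zero (hz : z ∈ regularSet) (u v : Pt) :
    curvForm expWeb 0 0 z u v = 0 := by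
  have hφ : ∀ w ∈ regularSet, HasFDerivAt
      (fun w : Pt => -(w.1 0 * w.2 0 + Real.log (w.1 0) + Real.log (w.2 0) + Real.log (w.2 1)))
      _ w := fun w ⟨hx₁, hy₁, hy₂⟩ =>
    (((((hasFDerivAt_x 0 w).mul (hasFDerivAt_y 0 w)).add ((hasFDerivAt_x 0 w).log hx₁)).add
      ((hasFDerivAt_y 0 w).log hy₁)).add ((hasFDerivAt_y 1 w).log hy₂)).neg
  refine curvForm_zero_zero_eq_zero (φ := fun w =>
    -(w.1 0 * w.2 0 + Real.log (w.1 0) + Real.log (w.2 0) + Real.log (w.2 1))) ?_ ?_ ?_ u v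
  · obtain ⟨hx₁, hy₁, hy₂⟩ := hz
    fun_prop (disch := assumption)
  · filter_upwards [isOpen_regularSet.mem_nhds hz] with w hw v
    rw [conn_expWeb_zero_zero hw, (hφ w hw).fderiv]
    simp only [neg_add_rev, add_apply, neg_apply, smul_apply, dy_apply, smul_eq_mul, dx_apply]
    ring
  · exact conn_eq_zero (fun j k => Gam_expWeb_one j k z) 0

theorem curvForm_expWeb_one_zero (hz : z ∈ regularSet) (u v : Pt) :
    curvForm expWeb 1 0 z u v = exp (z.1 0 * z.2 0) * (z.1 0)⁻¹ *
      ((z.2 0)⁻¹ * (u.1 0 * v.2 0 - v.1 0 * u.2 0)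
        + (z.2 1)⁻¹ * (u.1 0 * v.2 1 - v.1 0 * u.2 1)) := by
  have ⟨hx₁, hy₁, hy₂⟩ := hz
  rw [curvForm, fderiv_conn_expWeb_one_zero hz, fderiv_conn_expWeb_one_zero hz]
  simp only [Finset.sum_sub_distrib, Fin.sum_univ_two, conn_expWeb_one_zero hz,
    conn_expWeb_zero_zero hz, neg_add_rev, Gam_expWeb_one, implies_true, conn_eq_zero, zero_mul,
    add_zero]
  field_simp
  ring

theorem curv_expWeb_one (j k l : Fin 2) (z : Pt) : curv expWeb 1 j k l z = 0 :=
  curv_eq_zero (.of_forall fun w j k => Gam_expWeb_one j k w) j k l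

theorem curv_expWeb_zero_one_zero_zero_ne_zero (hz : z ∈ regularSet) :
    curv expWeb 0 1 0 0 z ≠ 0 := by
  have ⟨hx₁, hy₁, hy₂⟩ := hz
  simp [curv, curvForm_expWeb_one_zero hz, fr1_expWeb_zero hz, fr2_expWeb_zero hz, hx₁, hy₁, hy₂]

theorem pT_expWeb_zero (i : Fin 2) (z : Pt) : pT expWeb 0 i z = 0 :=
  nablaCov_zero_eq_zero (.of_forall fun w j k => Gam_expWeb_one j k w) _

theorem qT_expWeb_zero (i : Fin 2) (z : Pt) : qT expWeb 0 i z = 0 :=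
  nablaCov_zero_eq_zero (.of_forall fun w j k => Gam_expWeb_one j k w) _

theorem pS_expWeb_eq_qS (hz : z ∈ regularSet) : pS expWeb z = qS expWeb z := by
  simp only [pS, qS, pT_expWeb_zero, qT_expWeb_zero, pT_expWeb_one_zero hz, qT_expWeb_one_zero hz]

theorem pS_expWeb_ne_zero (hz : z ∈ regularSet) : pS expWeb z ≠ 0 := by
  have ⟨hx₁, hy₁, hy₂⟩ := hz
  simp [pS, pT_expWeb_zero, pT_expWeb_one_zero hz, hx₁, hy₁, hy₂]

theorem Delta_expWeb (hz : z ∈ regularSet) : Delta expWeb z = {v | v.1 1 = 0 ∧ v.2 1 = 0} := by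
  simp only [Delta_eq_of_cov_zero_eq_zero (cov_zero_eq_zero fun j k => Gam_expWeb_one j k z)
    (cov_expWeb_one_ne_zero hz), om1_expWeb_one, om2_expWeb_one]

theorem curv_expWeb_zero_zero_zero (i : Fin 2) (hz : z ∈ regularSet) :
    curv expWeb i 0 0 0 z = 0 := by
  fin_cases i
  · exact curvForm_expWeb_zero_zero hz _ _
  · exact curv_expWeb_one 0 0 0 z

end ExpWeb

theorem nonIsoclinic_expWeb (hsub : D ⊆ regularSet) : NonIsoclinic expWeb D := fun _ hz =>
  add_pos_of_pos_of_nonneg (sq_pos_of_ne_zero (pS_expWeb_ne_zero (hsub hz))) (sq_nonneg _)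

theorem integrable_Delta_expWeb (hD : IsOpen D) (hsub : D ⊆ regularSet) :
    Integrable D (Delta expWeb) := by
  let ι := ContinuousLinearMap.single ℝ (fun _ : Fin 2 => ℝ) 0
  refine integrable_of_eq_range (L := ι.prodMap ι) hD ?_ ?_
  · have hι : Function.Injective ι := Pi.single_injective (M := fun _ : Fin 2 => ℝ) 0
    exact hι.prodMap hι
  · intro z hz
    rw [Delta_expWeb (hsub hz)]
    ext v
    constructor
    · rintro ⟨hx, hy⟩
      refine ⟨(v.1 0, v.2 0), ?_⟩
      ext k <;> fin_cases k <;> simp [ι, hx, hy]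
    · rintro ⟨c, rfl⟩
      simp [ι]

theorem hexagonalOn_expWeb (hsub : D ⊆ regularSet) {U : Set (ℝ × ℝ)} {Φ : ℝ × ℝ → Pt}
    (hΦ : IsIntegralSurface D (Delta expWeb) U Φ) : HexagonalOn expWeb U Φ := by
  have htangent : ∀ w ∈ U, ∀ v ∈ tangentPlane Φ w, v.1 1 = 0 ∧ v.2 1 = 0 := fun w hw v hv => by
    rwa [hΦ.tangent w hw, Delta_expWeb (hsub (hΦ.mapsTo w hw))] at hv
  refine hexagonalOn_of_mul_eq_mul (s := (· 0)) (t := (· 0)) fun u hu => ?_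
  obtain ⟨W, hW, hinj⟩ := hΦ.exists_nhds_injOn hu ((dx 0).prod (dy 0)) fun v hv h₀ => by
    obtain ⟨hx₂, hy₂⟩ := htangent u hu v hv
    obtain ⟨hx₁, hy₁⟩ := Prod.ext_iff.1 h₀
    ext k <;> fin_cases k <;> assumption
  have hconst := hΦ.eventually_apply_eq hu (dy 1) fun w hw v hv => (htangent w hw v hv).2
  refine ⟨U ∩ (W ∩ {w | dy 1 (Φ w) = dy 1 (Φ u)}),
    Filter.inter_mem (hΦ.isOpen.mem_nhds hu) (Filter.inter_mem hW hconst),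
    Set.inter_subset_left, hinj.mono fun w hw => hw.2.1, fun A hA => ?_,
    fun A hA B hB hAB => ?_⟩
  · obtain ⟨hx₁, hy₁, -⟩ := hsub (hΦ.mapsTo A hA.1)
    exact ⟨hx₁, hy₁⟩
  · have hy₂ : (Φ A).2 1 = (Φ B).2 1 := hA.2.2.trans hB.2.2.symm
    have hexp : (Φ A).2 1 * exp ((Φ A).1 0 * (Φ A).2 0) =
        (Φ B).2 1 * exp ((Φ B).1 0 * (Φ B).2 0) := congrFun hAB 0
    rw [hy₂] at hexp
    exact Real.exp_injective (mul_left_cancel₀ (hsub (hΦ.mapsTo B hB.1)).2.2 hexp)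

theorem mul_sub_eq_one_of_mem_transversalPlane_expWeb {z : Pt} {η a b : Fin 2 → ℝ} (hη : η ≠ 0)
    (ha : (a, 0) ∈ transversalPlane expWeb η z) (hb : (0, b) ∈ transversalPlane expWeb η z)
    (ha₁ : a 1 = 1) (hb₁ : b 1 = 1) : z.2 1 * (z.2 0 * a 0 - z.1 0 * b 0) = 1 := by
  have hx := ha.1
  have hy := hb.2
  simp only [om1_expWeb_zero, om1_expWeb_one, ha₁] at hx
  simp only [om2_expWeb_zero, om2_expWeb_one, hb₁] at hy
  have hη₁ : η 1 ≠ 0 := by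
    intro h₁
    have h₀ : η 0 = 0 := by simpa [h₁] using hx
    exact hη (funext (Fin.forall_fin_two.2 ⟨h₀, h₁⟩))
  apply mul_left_cancel₀ (mul_ne_zero hη₁ (Real.exp_ne_zero (z.1 0 * z.2 0)))
  linear_combination hx - hy

theorem eq_zero_of_mem_transversalPlane_expWeb {z v : Pt} (hz : z ∈ regularSet)
    (hv : v ∈ transversalPlane expWeb ![1, 1] z) (hx₂ : v.1 1 = 0) (hy₂ : v.2 1 = 0) : v = 0 := by
  obtain ⟨hz₁, hz₂, hz₃⟩ := hz
  obtain ⟨hx₁, hy₁⟩ := hv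
  simp only [om1_expWeb_zero, om1_expWeb_one, hx₂] at hx₁
  simp only [om2_expWeb_zero, om2_expWeb_one, hy₂] at hy₁
  have hx₁ : v.1 0 = 0 := by simpa [hz₂, hz₃] using hx₁
  have hy₁ : v.2 0 = 0 := by simpa [hz₁, hz₃] using hy₁
  ext k <;> fin_cases k <;> assumption

theorem not_transversallyGeodesic_expWeb (hne : D.Nonempty) (hsub : D ⊆ regularSet) :
    ¬ TransversallyGeodesic expWeb D := by
  obtain ⟨z, hz⟩ := hne
  intro h
  obtain ⟨U, Φ, u, hΦ, hu, rfl, hplane, htransversal⟩ := h z hz ![1, 1] (by simp)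
  obtain ⟨g, X, Y, hgu, hprod⟩ := hΦ.exists_eq_prod_curves hu 1 1
    (fun w hw v hv => by
      obtain ⟨η, -, hη⟩ := htransversal w hw
      rw [hη] at hv ⊢
      exact fst_mem_transversalPlane hv)
    fun v hv => eq_zero_of_mem_transversalPlane_expWeb (hsub hz) (hplane ▸ hv)
  have hu₀ := hprod.self_of_nhds.2
  have hX' : deriv X ((Φ u).1 1) 0 ≠ 0 := by
    intro h₀
    have hmem := hu₀.tangent_left
    rw [hgu, hplane] at hmem
    have h₁ := hmem.1
    simp [om1_expWeb_zero, om1_expWeb_one, h₀, hu₀.deriv_left_apply] at h₁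
  refine not_eventually_mul_sub_eq_one (σ := fun s => X s 0) (σ' := fun s => deriv X s 0)
    (τ := fun t => Y t 0) (τ' := fun t => deriv Y t 0) (hasDerivAt_pi.1 hu₀.hasDerivAt_left 0) hX'
    (hprod.curry_nhds.self_of_nhds.mono fun t ht => hasDerivAt_pi.1 ht.2.hasDerivAt_right 0)
    (hprod.curry_nhds.mono fun s hs => hs.mono fun t ⟨hU, hp⟩ => ?_)
  obtain ⟨η, hη, hηplane⟩ := htransversal _ hU
  have hequation := mul_sub_eq_one_of_mem_transversalPlane_expWeb hη
    (hηplane ▸ hp.tangent_left) (hηplane ▸ hp.tangent_right) hp.deriv_left_apply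
    hp.deriv_right_apply
  have hy₂ : Y t 1 = t := hp.right_apply
  simpa only [hp.apply_eq, hy₂] using hequation

theorem not_curvatureTransversal_expWeb (hne : D.Nonempty) (hsub : D ⊆ regularSet) :
    ¬ CurvatureTransversal expWeb D := by
  obtain ⟨z, hz⟩ := hne
  intro h
  have hzero : ∀ k l, curv expWeb 0 0 k l z = 0 := fun k l =>
    curvForm_expWeb_zero_zero (hsub hz) _ _
  have hsym := h.sym3_curv_eq_zero hz fun j k l => curv_expWeb_one j k l z
  simp [sym3, hzero, curv_expWeb_zero_one_zero_zero_ne_zero (hsub hz)] at hsym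

theorem not_curvatureVanishes_expWeb (hne : D.Nonempty) (hsub : D ⊆ regularSet) :
    ¬ CurvatureVanishes expWeb D := fun h =>
  have ⟨z, hz⟩ := hne
  curv_expWeb_zero_one_zero_zero_ne_zero (hsub hz) (h z hz 0 1 0 0)

end Web322

end

theorem mainTheorem8 (D : Set Web322.Pt) (hD : IsOpen D) (hne : D.Nonempty)
    (hsub : ∀ z ∈ D, z.1 0 ≠ 0 ∧ z.2 0 ≠ 0 ∧ z.2 1 ≠ 0) :
    Web322.IsWeb Web322.expWeb D ∧
    Web322.NonIsoclinicGeodesic Web322.expWeb D ∧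
    Web322.NonIsoclinic Web322.expWeb D ∧
    Web322.ClassA31 Web322.expWeb D ∧
    Web322.ClassA32 Web322.expWeb D ∧
    Web322.ClassE321 Web322.expWeb D ∧
    Web322.ClassG3 Web322.expWeb D ∧
    (∀ z ∈ D, ∀ j k l, Web322.curv Web322.expWeb 1 j k l z = 0) ∧
    ¬ Web322.CurvatureVanishes Web322.expWeb D ∧
    Web322.ClassC Web322.expWeb D := by
  have hA31 := Web322.classA31_of_Gam_one_eq_zero (Web322.isWeb_expWeb hD hsub)
    (fun z _ j k => Web322.Gam_expWeb_one j k z)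
    (fun z hz => Web322.cov_expWeb_one_ne_zero (hsub z hz)) (Web322.nonIsoclinic_expWeb hsub)
    (Web322.integrable_Delta_expWeb hD hsub)
  have hA32 : Web322.ClassA32 Web322.expWeb D :=
    ⟨hA31.toClassA3, fun _ _ hΦ => Web322.hexagonalOn_expWeb hsub hΦ,
      fun z hz i => Web322.curv_expWeb_zero_zero_zero i (hsub z hz)⟩
  have hE321 : Web322.ClassE321 Web322.expWeb D :=
    ⟨hA31.p1, hA31.q1,
      fun z hz => (Web322.pT_expWeb_one_zero (hsub z hz)).trans
        (Web322.qT_expWeb_one_zero (hsub z hz)).symm,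
      fun z hz => Web322.pT_expWeb_one_one (hsub z hz)⟩
  have hG3 : Web322.ClassG3 Web322.expWeb D := fun z hz =>
    ⟨Web322.pS_expWeb_eq_qS (hsub z hz), Web322.pS_expWeb_ne_zero (hsub z hz)⟩
  exact ⟨hA31.isWeb, hA31.cov_ne_zero, hA31.nonIsoclinic, hA31, hA32, hE321, hG3,
    fun z _ j k l => Web322.curv_expWeb_one j k l z,
    Web322.not_curvatureVanishes_expWeb hne hsub,
    Web322.not_transversallyGeodesic_expWeb hne hsub,
    Web322.not_curvatureTransversal_expWeb hne hsub⟩
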